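/- Let $n=2^m$ with $m\ge 0$ an integer. The query register consists of $m+1$ qubits: $m$ index qubits, numbered $1,\dots,m$, which hold the binary expansion of $x\in\{0,\dots,n-1\}$ (qubit $j$ holds the bit of weight $2^{j-1}$), and a target qubit, numbered $0$, which holds $y\in\{0,1\}$. For $f:\{0,\dots,n-1\}\to\{0,1\}$ let $\mathscr O_f$ be the channel $\rho\mapsto O_f\rho O_f^*$ with $O_f|x,y\rangle=(-1)^{f(x)y}|x,y\rangle$. For $j\in\{0,1,\dots,m\}$ and $r\in[0,1]$ let $\mathscr N_{j,r}$ be the channel that acts as the identity with probability $1-r$ and completely depolarizes the $j$-th query qubit with probability $r$, and let $\mathscr O_{f,j,r}=\mathscr N_{j,r}\circ\mathscr O_f\circ\mathscr N_{j,r}$ be the noisy oracle. A quantum query algorithm has a finite-dimensional workspace in addition to the query register and starts in a fixed state of the two. It makes $\tau$ calls to $\mathscr O_{f,j,r}$ (acting on the query register and as the identity on the workspace), each followed by a channel on the whole space, and ends with a measurement whose outcome is an element of $\{0,\dots,n-1\}$; the initial state, the channels and the measurement do not depend on $f$, but may depend on $n$, $j$, $r$ and $\epsilon$. The algorithm solves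 unstructured search in the worst case with probability at least $1-\epsilon$ if, for every $f$ with exactly one marked element (one $x$ with $f(x)=1$), its outcome is the marked element with probability at least $1-\epsilon$. Theorem. For every integer $m\ge 0$ with $n=2^m$, every $j\in\{0,1,\dots,m\}$, every $r\in[0,1]$ and every real $\epsilon$, every quantum query algorithm with access to $\mathscr O_{f,j,r}$ that solves unstructured search among $n$ elements in the worst case with probability at least $1-\epsilon$ must make at least $$\frac{nr(1-\epsilon)}{2000}-1$$ queries to $\mathscr O_{f,j,r}$. -/

import Mathlib

open scoped Matrix Kronecker ComplexOrder

namespace NoisySearch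

noncomputable section

/-- Labels `(x, y)` of the computational basis of the query register: the index register holds
`x ∈ {0, …, n - 1}` with `n = 2 ^ m`, and the target qubit holds the bit `y`. -/
abbrev Query (m : ℕ) : Type := Fin (2 ^ m) × Bool

/-- The value of the `j`-th query qubit in the basis state `q = (x, y)`: the target bit `y` for
`j = 0`, and for `1 ≤ j ≤ m` the bit `x_j` of the binary expansion `x = ∑ j, 2 ^ (j - 1) * x_j`. -/
def qubitVal {m : ℕ} (q : Query m) (j : Fin (m + 1)) : Bool :=
  if j = 0 then q.2 else (q.1 : ℕ).testBit ((j : ℕ) - 1)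

/-- The operator on the query register that acts as the one-qubit operator `σ` on the `j`-th query
qubit and as the identity on all other query qubits. -/
def onQubit {m : ℕ} (j : Fin (m + 1)) (σ : Matrix Bool Bool ℂ) : Matrix (Query m) (Query m) ℂ :=
  Matrix.of fun p q =>
    if ∀ i, i ≠ j → qubitVal p i = qubitVal q i then σ (qubitVal p j) (qubitVal q j) else 0

/-- The Pauli operators `I`, `X`, `Y`, `Z` (with `false` and `true` labelling `|0⟩` and `|1⟩`). -/
def pauli : Fin 4 → Matrix Bool Bool ℂ :=
  ![1,
    Matrix.of fun a b => if a = b then 0 else 1,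
    Matrix.of fun a b => if a = b then 0 else if a then Complex.I else -Complex.I,
    Matrix.of fun a b => if a = b then (if a then -1 else 1) else 0]

/-- The faultless phase oracle `O_f = ∑ x y, (-1) ^ (f x * y) |x, y⟩⟨x, y|`. -/
def phaseOracle {m : ℕ} (f : Fin (2 ^ m) → Bool) : Matrix (Query m) (Query m) ℂ :=
  Matrix.diagonal fun q => if f q.1 && q.2 then -1 else 1

/-- The algorithm's space: the query register together with a workspace with basis `W`. -/
abbrev Op (m : ℕ) (W : Type) : Type := Matrix (Query m × W) (Query m × W) ℂ

/-- An operator on the query register, acting as the identity on the workspace. -/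
def onQuery {m : ℕ} (W : Type) [DecidableEq W] (G : Matrix (Query m) (Query m) ℂ) : Op m W :=
  G ⊗ₖ (1 : Matrix W W ℂ)

variable {m : ℕ} {W : Type} [Fintype W] [DecidableEq W]

/-- Complete depolarization of the `j`-th query qubit (Kraus operators `σ_P / 2`). -/
def fullDepolarize (j : Fin (m + 1)) (ρ : Op m W) : Op m W :=
  ∑ P : Fin 4, onQuery W ((1 / 2 : ℂ) • onQubit j (pauli P)) * ρ *
    (onQuery W ((1 / 2 : ℂ) • onQubit j (pauli P)))ᴴ

/-- The depolarizing noise of rate `r`: with probability `1 - r` the identity, with probability `r`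
complete depolarization of the `j`-th query qubit. -/
def noise (j : Fin (m + 1)) (r : ℝ) (ρ : Op m W) : Op m W :=
  ((1 - r : ℝ) : ℂ) • ρ + (r : ℂ) • fullDepolarize j ρ

/-- The faultless oracle call `ρ ↦ O_f ρ O_f*`. -/
def oracleCall (f : Fin (2 ^ m) → Bool) (ρ : Op m W) : Op m W :=
  onQuery W (phaseOracle f) * ρ * (onQuery W (phaseOracle f))ᴴ

/-- The noisy oracle call: noise on the `j`-th query qubit independently before and after the
faultless call. -/
def noisyOracle (f : Fin (2 ^ m) → Bool) (j : Fin (m + 1)) (r : ℝ) (ρ : Op m W) : Op m W :=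
  noise j r (oracleCall f (noise j r ρ))

/-- A quantum channel (completely positive trace-preserving map) on the finite-dimensional space
with basis `X`, presented by a finite family of Kraus operators. -/
structure Channel (X : Type) [Fintype X] [DecidableEq X] where
  /-- number of Kraus operators -/
  num : ℕ
  /-- Kraus operators -/
  kraus : Fin num → Matrix X X ℂ
  complete : ∑ k, (kraus k)ᴴ * kraus k = 1

/-- The action of a channel. -/
def Channel.apply {X : Type} [Fintype X] [DecidableEq X] (C : Channel X) (ρ : Matrix X X ℂ) :
    Matrix X X ℂ :=
  ∑ k, C.kraus k * ρ * (C.kraus k)ᴴ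

end

/-- A quantum query algorithm that outputs an element of `{0, …, 2 ^ m - 1}`. It starts in an
arbitrary state of query register and workspace, makes `queries` oracle calls, each followed by
an arbitrary oracle-independent channel on the whole space (a unitary being a special case), and
finally performs a measurement. The channels `step t` with `t ≥ queries` are never used. -/
structure Algorithm (m : ℕ) where
  /-- number of oracle calls -/
  queries : ℕ
  /-- basis labels of the workspace -/
  W : Type
  [fintypeW : Fintype W]
  [decEqW : DecidableEq W]
  /-- initial density operator -/
  init : Op m W
  init_posSemidef : init.PosSemidef
  init_trace : init.trace = 1
  /-- operation performed after oracle call number `t + 1` -/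
  step : ℕ → Channel (Query m × W)
  /-- final measurement (a POVM) -/
  povm : Fin (2 ^ m) → Op m W
  povm_posSemidef : ∀ x, (povm x).PosSemidef
  povm_sum : ∑ x, povm x = 1

attribute [instance] Algorithm.fintypeW Algorithm.decEqW

noncomputable section

variable {m : ℕ}

/-- The state after `t` noisy oracle calls (and the operations following them) on input `f`. -/
def Algorithm.state (A : Algorithm m) (j : Fin (m + 1)) (r : ℝ) (f : Fin (2 ^ m) → Bool) :
    ℕ → Op m A.W
  | 0 => A.init
  | t + 1 => (A.step t).apply (noisyOracle f j r (A.state j r f t))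

/-- The probability that the algorithm outputs a marked element of `f`. -/
def Algorithm.successProb (A : Algorithm m) (j : Fin (m + 1)) (r : ℝ)
    (f : Fin (2 ^ m) → Bool) : ℝ :=
  ∑ x with f x = true, ((A.povm x * A.state j r f A.queries).trace).re

/-- With access to the noisy oracle, the algorithm solves unstructured search with worst-case
success probability at least `p`: on every `f` with exactly one marked element, it outputs the
marked element with probability at least `p`. -/
def Algorithm.SolvesSearch (A : Algorithm m) (j : Fin (m + 1)) (r p : ℝ) : Prop :=
  ∀ f : Fin (2 ^ m) → Bool, (∃! x, f x = true) → p ≤ A.successProb j r f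

end

end NoisySearch

set_option linter.unusedSectionVars false

/-! Expand the noise into Pauli errors `P` before and `Q` after the call. Moving `P` behind the
oracle turns the reflection about `v = (x, 1)` into one about `v` or about its `j`-toggle `v'`. The
branches `(P, Q) = (1, X)` and `(X, 1)` end in the same unitary `X` with the same weight, so nothing
tells which reflection took place. Up to a discarded positive part, both act as the average of the
two reflections, which annihilates `v` and `v'`. Hence amplitude there is lost at a rate of order
`r` per query.

Compare a subnormalized purified state `Φ x`, which keeps only the undiscarded part, with a
reference `Ψ` run on the trivial oracle. In the potential `2‖Ψ - Φ x‖² + (1 - ‖Φ x‖²)` a query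
creates a cross term between the amplitudes of `Ψ` and `Φ x` on `v, v'`. The lost norm of `Φ x`
absorbs it, leaving `128 / r` times the weight of `Ψ` there (`sum_blurSign_le`). Over all `x` these
weights sum to at most 2, so the total potential grows by at most `256 / r` per query
(`Tracked.noisyOracle`), linearly rather than quadratically as without noise. The potential bounds
the total success probability (`Tracked.sum_success_le`). -/

namespace NoisySearch

/-! ### Flipping one qubit of a basis state -/

section Bits

variable {m : ℕ}

theorem qubitVal_injective : Function.Injective (qubitVal (m := m)) := by
  rintro ⟨x, y⟩ ⟨x', y'⟩ h
  have h0 := congrFun h 0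
  simp only [qubitVal, if_true] at h0
  refine Prod.ext (Fin.ext (Nat.eq_of_testBit_eq fun i => ?_)) h0
  by_cases hi : i < m
  · have := congrFun h (Fin.succ ⟨i, hi⟩)
    simpa [qubitVal, Fin.succ_ne_zero] using this
  · have hp : 2 ^ m ≤ 2 ^ i := Nat.pow_le_pow_right (by norm_num) (not_lt.1 hi)
    rw [Nat.testBit_eq_false_of_lt (lt_of_lt_of_le x.2 hp),
      Nat.testBit_eq_false_of_lt (lt_of_lt_of_le x'.2 hp)]

/-- Basis states of the query register correspond to strings of qubit values. -/
noncomputable def bitsEquiv : Query m ≃ (Fin (m + 1) → Bool) :=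
  Equiv.ofBijective qubitVal <| (Fintype.bijective_iff_injective_and_card _).2
    ⟨qubitVal_injective, by simp [pow_succ]⟩

/-- Add the bit `b` to the `j`-th qubit. -/
noncomputable def toggle (j : Fin (m + 1)) (b : Bool) (q : Query m) : Query m :=
  bitsEquiv.symm (Function.update (qubitVal q) j (xor (qubitVal q j) b))

theorem qubitVal_toggle (j : Fin (m + 1)) (b : Bool) (q : Query m) :
    qubitVal (toggle j b q) = Function.update (qubitVal q) j (xor (qubitVal q j) b) :=
  bitsEquiv.apply_symm_apply _

theorem eq_toggle_iff (j : Fin (m + 1)) (b : Bool) (p q : Query m) :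
    q = toggle j b p ↔
      (∀ i, i ≠ j → qubitVal p i = qubitVal q i) ∧ qubitVal q j = xor (qubitVal p j) b := by
  rw [← qubitVal_injective.eq_iff, qubitVal_toggle, Function.eq_update_iff]
  constructor
  · rintro ⟨h1, h2⟩
    exact ⟨fun i hi => (h2 i hi).symm, h1⟩
  · rintro ⟨h1, h2⟩
    exact ⟨h2, fun i hi => (h1 i hi).symm⟩

@[simp] theorem toggle_toggle (j : Fin (m + 1)) (b : Bool) (q : Query m) :
    toggle j b (toggle j b q) = q := by
  symm
  rw [eq_toggle_iff]
  constructor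
  · intro i hi
    simp [qubitVal_toggle, hi]
  · simp [qubitVal_toggle]

@[simp] theorem toggle_false (j : Fin (m + 1)) (q : Query m) : toggle j false q = q := by
  symm
  rw [eq_toggle_iff]
  simp

theorem toggle_true_ne (j : Fin (m + 1)) (q : Query m) : toggle j true q ≠ q := by
  intro h
  have := ((eq_toggle_iff j true q q).1 h.symm).2
  simp at this

end Bits

/-! ### Pauli operators as phased permutations of the basis -/

section Pauli

variable {m : ℕ}

/-- Whether the Pauli operator flips the computational basis. -/
def flips : Fin 4 → Bool := ![false, true, true, false]

/-- The nonzero entry of a Pauli operator in the row labelled by the given bit. -/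
noncomputable def phase (P : Fin 4) (b : Bool) : ℂ :=
  (![1, 1, if b then Complex.I else -Complex.I, if b then -1 else 1] : Fin 4 → ℂ) P

theorem pauli_apply (P : Fin 4) (a b : Bool) :
    pauli P a b = if b = xor a (flips P) then phase P a else 0 := by
  fin_cases P <;> cases a <;> cases b <;> simp [pauli, flips, phase]

theorem star_phase_mul_self (P : Fin 4) (b : Bool) : star (phase P b) * phase P b = 1 := by
  fin_cases P <;> cases b <;> simp [phase]

theorem onQubit_pauli_apply (j : Fin (m + 1)) (P : Fin 4) (p q : Query m) :
    onQubit j (pauli P) p q =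
      if q = toggle j (flips P) p then phase P (qubitVal p j) else 0 := by
  simp only [onQubit, Matrix.of_apply, pauli_apply, eq_toggle_iff]
  split_ifs <;> simp_all

theorem onQubit_pauli_isometry (j : Fin (m + 1)) (P : Fin 4) :
    (onQubit j (pauli P))ᴴ * onQubit j (pauli P) = 1 := by
  ext a b
  rw [Matrix.mul_apply, Finset.sum_eq_single (toggle j (flips P) a)]
  · rw [Matrix.conjTranspose_apply, onQubit_pauli_apply, onQubit_pauli_apply]
    by_cases h : a = b
    · subst h
      simpa using star_phase_mul_self P _
    · simp [h, Ne.symm h]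
  · intro p _ hp
    rw [Matrix.conjTranspose_apply, onQubit_pauli_apply, if_neg, star_zero, zero_mul]
    rintro rfl
    simp at hp
  · simp

theorem onQubit_pauli_zero (j : Fin (m + 1)) : onQubit j (pauli 0) = 1 := by
  ext a b
  rw [onQubit_pauli_apply]
  simp only [flips, phase, Matrix.cons_val_zero, toggle_false, Matrix.one_apply, eq_comm]

/-- A Pauli operator permutes the basis up to phases, so it normalizes the diagonal operators; this
moves the first noise behind the oracle. -/
theorem diagonal_mul_onQubit_pauli (j : Fin (m + 1)) (P : Fin 4) (s : Query m → ℂ) :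
    Matrix.diagonal s * onQubit j (pauli P) =
      onQubit j (pauli P) * Matrix.diagonal fun q => s (toggle j (flips P) q) := by
  ext a b
  rw [Matrix.diagonal_mul, Matrix.mul_diagonal, onQubit_pauli_apply]
  split_ifs with h
  · subst h
    simp [mul_comm]
  · simp

end Pauli

section OnQuery

variable {m : ℕ} {W : Type} [Fintype W] [DecidableEq W]

theorem onQuery_mul (A B : Matrix (Query m) (Query m) ℂ) :
    onQuery W (A * B) = onQuery W A * onQuery W B := by
  simp [onQuery, ← Matrix.mul_kronecker_mul]

theorem onQuery_one : onQuery W (1 : Matrix (Query m) (Query m) ℂ) = 1 := by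
  simp [onQuery]

theorem onQuery_conjTranspose (A : Matrix (Query m) (Query m) ℂ) :
    (onQuery W A)ᴴ = onQuery W Aᴴ := by
  simp [onQuery, Matrix.conjTranspose_kronecker]

theorem onQuery_smul (c : ℂ) (A : Matrix (Query m) (Query m) ℂ) :
    onQuery W (c • A) = c • onQuery W A := by
  simp [onQuery, Matrix.smul_kronecker]

theorem onQuery_diagonal_mul_apply {I : Type} (s : Query m → ℂ) (M : Matrix (Query m × W) I ℂ)
    (z : Query m × W) (i : I) : (onQuery W (Matrix.diagonal s) * M) z i = s z.1 * M z i := by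
  rw [onQuery, ← Matrix.diagonal_one, Matrix.diagonal_kronecker_diagonal, Matrix.diagonal_mul]
  simp

end OnQuery

/-! ### Purifications as rectangular matrices, with the Frobenius norm -/

section FrobeniusNorm

variable {X I κ : Type} [Fintype X] [Fintype I] [Fintype κ]

/-- The square of the Frobenius norm. -/
noncomputable def normSq (M : Matrix X I ℂ) : ℝ := ∑ x, ∑ i, Complex.normSq (M x i)

theorem normSq_eq_trace (M : Matrix X I ℂ) : normSq M = ((M * Mᴴ).trace).re := by
  simp [normSq, Matrix.trace, Matrix.mul_apply, Complex.mul_conj]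

theorem normSq_sub_le (M N : Matrix X I ℂ) : normSq M ≤ 2 * normSq N + 2 * normSq (N - M) := by
  simp only [normSq, Finset.mul_sum, ← Finset.sum_add_distrib]
  refine Finset.sum_le_sum fun x _ => Finset.sum_le_sum fun i _ => ?_
  simp only [Matrix.sub_apply, Complex.normSq_apply, Complex.sub_re, Complex.sub_im]
  -- The slack `2N² + 2(N - M)² - M²` equals `(M - 2N)²`.
  nlinarith [sq_nonneg ((M x i).re - 2 * (N x i).re), sq_nonneg ((M x i).im - 2 * (N x i).im)]

theorem normSq_smul (c : ℂ) (M : Matrix X I ℂ) :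
    normSq (c • M) = Complex.normSq c * normSq M := by
  simp [normSq, Finset.mul_sum]

theorem sum_normSq_mul [DecidableEq X] (K : κ → Matrix X X ℂ) (hK : ∑ k, (K k)ᴴ * K k = 1)
    (M : Matrix X I ℂ) : ∑ k, normSq (K k * M) = normSq M := by
  simp only [normSq_eq_trace]
  rw [← Complex.re_sum, ← Matrix.trace_sum]
  congr 1
  calc (∑ k, K k * M * (K k * M)ᴴ).trace = ((∑ k, (K k)ᴴ * K k) * (M * Mᴴ)).trace := by
        rw [Matrix.trace_sum, Finset.sum_mul, Matrix.trace_sum]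
        refine Finset.sum_congr rfl fun k _ => ?_
        rw [Matrix.conjTranspose_mul, Matrix.mul_assoc (K k)ᴴ, Matrix.trace_mul_comm (K k)ᴴ]
        simp only [Matrix.mul_assoc]
    _ = (M * Mᴴ).trace := by rw [hK, Matrix.one_mul]

theorem normSq_isometry_mul [DecidableEq X] (U : Matrix X X ℂ) (hU : Uᴴ * U = 1)
    (M : Matrix X I ℂ) : normSq (U * M) = normSq M := by
  simpa using sum_normSq_mul (fun _ : Unit => U) (by simpa using hU) M

/-- The matrices `F k` put side by side. -/
def stack (F : κ → Matrix X I ℂ) : Matrix X (I × κ) ℂ := Matrix.of fun x ik => F ik.2 x ik.1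

theorem stack_mul_conjTranspose (F : κ → Matrix X I ℂ) :
    stack F * (stack F)ᴴ = ∑ k, F k * (F k)ᴴ := by
  ext x y
  simp only [Matrix.mul_apply, stack, Matrix.sum_apply, Fintype.sum_prod_type,
    Matrix.conjTranspose_apply, Matrix.of_apply]
  exact Finset.sum_comm

theorem normSq_stack (F : κ → Matrix X I ℂ) : normSq (stack F) = ∑ k, normSq (F k) := by
  rw [normSq_eq_trace, stack_mul_conjTranspose, Matrix.trace_sum, Complex.re_sum]
  simp only [normSq_eq_trace]

theorem stack_sub (F G : κ → Matrix X I ℂ) :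
    stack F - stack G = stack fun k => F k - G k := rfl

open scoped MatrixOrder in
theorem exists_eq_mul_conjTranspose {M : Matrix X X ℂ} (hM : M.PosSemidef) :
    ∃ B : Matrix X X ℂ, M = B * Bᴴ := by
  classical
  obtain ⟨B, hB⟩ := CStarAlgebra.nonneg_iff_eq_star_mul_self.mp hM.nonneg
  exact ⟨Bᴴ, by simpa [Matrix.star_eq_conjTranspose] using hB⟩

theorem trace_mul_nonneg_of_posSemidef {M R : Matrix X X ℂ} (hM : M.PosSemidef)
    (hR : R.PosSemidef) : 0 ≤ ((M * R).trace).re := by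
  obtain ⟨B, rfl⟩ := exists_eq_mul_conjTranspose hR
  have h : (M * (B * Bᴴ)).trace = (Bᴴ * M * B).trace := by
    rw [← Matrix.mul_assoc, Matrix.trace_mul_comm, ← Matrix.mul_assoc]
  rw [h]
  exact (Complex.le_def.1 (hM.conjTranspose_mul_mul_same B).trace_nonneg).1

end FrobeniusNorm

section Kraus

variable {X κ : Type} [Fintype X] [DecidableEq X] [Fintype κ]

theorem kraus_sub (K : κ → Matrix X X ℂ) (ρ σ : Matrix X X ℂ) :
    ∑ k, K k * (ρ - σ) * (K k)ᴴ = ∑ k, K k * ρ * (K k)ᴴ - ∑ k, K k * σ * (K k)ᴴ := by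
  simp [Matrix.mul_sub, Matrix.sub_mul]

theorem kraus_posSemidef (K : κ → Matrix X X ℂ) {ρ : Matrix X X ℂ} (hρ : ρ.PosSemidef) :
    (∑ k, K k * ρ * (K k)ᴴ).PosSemidef :=
  Matrix.posSemidef_sum _ fun k _ => hρ.mul_mul_conjTranspose_same (K k)

theorem kraus_trace (K : κ → Matrix X X ℂ) (hK : ∑ k, (K k)ᴴ * K k = 1) (ρ : Matrix X X ℂ) :
    (∑ k, K k * ρ * (K k)ᴴ).trace = ρ.trace := by
  calc _ = ((∑ k, (K k)ᴴ * K k) * ρ).trace := by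
        rw [Matrix.trace_sum, Finset.sum_mul, Matrix.trace_sum]
        refine Finset.sum_congr rfl fun k _ => ?_
        rw [Matrix.trace_mul_comm, ← Matrix.mul_assoc]
    _ = ρ.trace := by rw [hK, Matrix.one_mul]

/-- If the columns of `M` purify a state, stacking records the Kraus index in the purifying system.
-/
theorem kraus_gram {I : Type} [Fintype I] (K : κ → Matrix X X ℂ) (M : Matrix X I ℂ) :
    stack (fun k => K k * M) * (stack fun k => K k * M)ᴴ = ∑ k, K k * (M * Mᴴ) * (K k)ᴴ := by
  rw [stack_mul_conjTranspose]
  simp [Matrix.conjTranspose_mul, Matrix.mul_assoc]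

end Kraus

/-! ### Kraus form of the noisy oracle, and its blurred part -/

section NoisyOracle

variable {m : ℕ} {W : Type} [Fintype W] [DecidableEq W]

/-- The probability with which depolarizing noise of rate `r` applies each Pauli operator. -/
noncomputable def weight (r : ℝ) : Fin 4 → ℝ := ![1 - 3 * r / 4, r / 4, r / 4, r / 4]

theorem weight_nonneg {r : ℝ} (hr0 : 0 ≤ r) (hr1 : r ≤ 1) (P : Fin 4) : 0 ≤ weight r P := by
  fin_cases P <;> simp [weight] <;> linarith

theorem sum_weight (r : ℝ) : ∑ P, weight r P = 1 := by
  simp [weight, Fin.sum_univ_four]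
  ring

/-- Complete depolarization is the uniform mixture of the four Paulis, so the identity gets weight
`1 - r + r / 4`. -/
theorem noise_eq (j : Fin (m + 1)) (r : ℝ) (ρ : Op m W) :
    noise j r ρ = ∑ P, (weight r P : ℂ) •
      (onQuery W (onQubit j (pauli P)) * ρ * (onQuery W (onQubit j (pauli P)))ᴴ) := by
  simp only [noise, fullDepolarize, onQuery_smul, Matrix.conjTranspose_smul, Matrix.smul_mul,
    Matrix.mul_smul, Fin.sum_univ_four, onQubit_pauli_zero, onQuery_one, weight,
    Matrix.conjTranspose_one, Matrix.one_mul, Matrix.mul_one]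
  have h : star (1 / 2 : ℂ) = 1 / 2 := by simp
  simp only [h, smul_add, smul_smul]
  simp only [Matrix.cons_val]
  push_cast
  module

/-- The Pauli operator `P` before the oracle call, moved behind it, followed by `Q`. -/
noncomputable def pauliPair (W : Type) [DecidableEq W] (j : Fin (m + 1)) (k : Fin 4 × Fin 4) :
    Op m W :=
  onQuery W (onQubit j (pauli k.2) * onQubit j (pauli k.1))

theorem pauliPair_isometry (j : Fin (m + 1)) (k : Fin 4 × Fin 4) :
    (pauliPair W j k)ᴴ * pauliPair W j k = 1 := by
  rw [pauliPair, onQuery_conjTranspose, ← onQuery_mul, Matrix.conjTranspose_mul, Matrix.mul_assoc,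
    ← Matrix.mul_assoc (onQubit j (pauli k.2))ᴴ, onQubit_pauli_isometry, Matrix.one_mul,
    onQubit_pauli_isometry, onQuery_one]

/-- The reflection about the basis state `v`, conjugated by the Pauli operator `P`. -/
noncomputable def reflSign (j : Fin (m + 1)) (v : Query m) (P : Fin 4) (q : Query m) : ℝ :=
  if toggle j (flips P) q = v then -1 else 1

theorem reflSign_sq (j : Fin (m + 1)) (v : Query m) (P : Fin 4) (q : Query m) :
    reflSign j v P q * reflSign j v P q = 1 := by
  unfold reflSign
  split_ifs <;> norm_num

/-- Multiplication of the basis states of the query register by real numbers. -/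
noncomputable def diagOp (W : Type) [DecidableEq W] (s : Query m → ℝ) : Op m W :=
  onQuery W (Matrix.diagonal fun q => (s q : ℂ))

theorem diagOp_mul_apply {I : Type} (s : Query m → ℝ) (M : Matrix (Query m × W) I ℂ)
    (z : Query m × W) (i : I) : (diagOp W s * M) z i = s z.1 * M z i :=
  onQuery_diagonal_mul_apply _ _ _ _

theorem diagOp_conjTranspose (s : Query m → ℝ) : (diagOp W s)ᴴ = diagOp W s := by
  rw [diagOp, onQuery_conjTranspose, Matrix.diagonal_conjTranspose]
  congr 2
  ext q
  simp

theorem diagOp_add (s t : Query m → ℝ) :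
    diagOp W (fun q => s q + t q) = diagOp W s + diagOp W t := by
  simp only [diagOp, onQuery, Complex.ofReal_add, ← Matrix.add_kronecker, Matrix.diagonal_add]

theorem diagOp_sub (s t : Query m → ℝ) :
    diagOp W (fun q => s q - t q) = diagOp W s - diagOp W t := by
  rw [eq_sub_iff_add_eq, ← diagOp_add]
  simp

theorem diagOp_mul (s t : Query m → ℝ) :
    diagOp W s * diagOp W t = diagOp W fun q => s q * t q := by
  simp [diagOp, ← onQuery_mul, Matrix.diagonal_mul_diagonal]

theorem diagOp_one : diagOp W (fun _ : Query m => 1) = 1 := by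
  simp [diagOp, onQuery_one]

/-- Kraus operators `√(w_P w_Q) Q P S`, with `S` a diagonal operator depending on `(P, Q)`. -/
noncomputable def pairKraus (W : Type) [DecidableEq W] [Fintype W] (j : Fin (m + 1)) (r : ℝ)
    (s : Fin 4 × Fin 4 → Query m → ℝ) (k : Fin 4 × Fin 4) : Op m W :=
  (Real.sqrt (weight r k.1 * weight r k.2) : ℂ) • (pauliPair W j k * diagOp W (s k))

theorem pairKraus_conj {r : ℝ} (hr0 : 0 ≤ r) (hr1 : r ≤ 1) (j : Fin (m + 1))
    (s : Fin 4 × Fin 4 → Query m → ℝ) (k : Fin 4 × Fin 4) (ρ : Op m W) :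
    pairKraus W j r s k * ρ * (pairKraus W j r s k)ᴴ =
      ((weight r k.1 * weight r k.2 : ℝ) : ℂ) •
        (pauliPair W j k * (diagOp W (s k) * ρ * diagOp W (s k)) * (pauliPair W j k)ᴴ) := by
  have h := mul_nonneg (weight_nonneg hr0 hr1 k.1) (weight_nonneg hr0 hr1 k.2)
  rw [pairKraus, Matrix.conjTranspose_smul, Matrix.conjTranspose_mul, diagOp_conjTranspose,
    Matrix.smul_mul, Matrix.smul_mul, Matrix.mul_smul, smul_smul]
  congr 1
  · rw [Complex.star_def, Complex.conj_ofReal, ← Complex.ofReal_mul, Real.mul_self_sqrt h]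
  · simp only [Matrix.mul_assoc]

theorem normSq_pairKraus_mul {r : ℝ} (hr0 : 0 ≤ r) (hr1 : r ≤ 1) (j : Fin (m + 1))
    (s : Fin 4 × Fin 4 → Query m → ℝ) (k : Fin 4 × Fin 4) {I : Type} [Fintype I]
    (M : Matrix (Query m × W) I ℂ) :
    normSq (pairKraus W j r s k * M) =
      weight r k.1 * weight r k.2 * normSq (diagOp W (s k) * M) := by
  have h := mul_nonneg (weight_nonneg hr0 hr1 k.1) (weight_nonneg hr0 hr1 k.2)
  rw [pairKraus, Matrix.smul_mul, normSq_smul, Matrix.mul_assoc,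
    normSq_isometry_mul _ (pauliPair_isometry j k), Complex.normSq_ofReal, Real.mul_self_sqrt h]

theorem pairKraus_complete {r : ℝ} (hr0 : 0 ≤ r) (hr1 : r ≤ 1) (j : Fin (m + 1))
    (s : Fin 4 × Fin 4 → Query m → ℝ) (hs : ∀ k q, s k q * s k q = 1) :
    ∑ k, (pairKraus W j r s k)ᴴ * pairKraus W j r s k = 1 := by
  have key : ∀ k, (pairKraus W j r s k)ᴴ * pairKraus W j r s k =
      ((weight r k.1 * weight r k.2 : ℝ) : ℂ) • (1 : Op m W) := by
    intro k
    have h := mul_nonneg (weight_nonneg hr0 hr1 k.1) (weight_nonneg hr0 hr1 k.2)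
    rw [pairKraus, Matrix.conjTranspose_smul, Matrix.conjTranspose_mul, diagOp_conjTranspose,
      Matrix.smul_mul, Matrix.mul_smul, smul_smul]
    congr 1
    · rw [Complex.star_def, Complex.conj_ofReal, ← Complex.ofReal_mul, Real.mul_self_sqrt h]
    · rw [Matrix.mul_assoc, ← Matrix.mul_assoc (pauliPair W j k)ᴴ, pauliPair_isometry,
        Matrix.one_mul, diagOp_mul]
      simp only [hs, diagOp_one]
  simp only [key]
  rw [← Finset.sum_smul, ← Complex.ofReal_sum, ← Finset.univ_product_univ,
    Finset.sum_product, ← Finset.sum_mul_sum, sum_weight]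
  simp

/-- The function whose only marked element is `x`. -/
def mark (x : Fin (2 ^ m)) (y : Fin (2 ^ m)) : Bool := decide (y = x)

theorem onQuery_phaseOracle_mark (x : Fin (2 ^ m)) (j : Fin (m + 1)) (P : Fin 4) :
    onQuery W (phaseOracle (mark x)) * onQuery W (onQubit j (pauli P)) =
      onQuery W (onQubit j (pauli P)) * diagOp W (reflSign j (x, true) P) := by
  rw [diagOp, ← onQuery_mul, ← onQuery_mul, phaseOracle, diagonal_mul_onQubit_pauli]
  congr 3
  ext q
  simp only [reflSign, mark, Prod.ext_iff, Bool.and_eq_true, decide_eq_true_eq]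
  split_ifs <;> simp

theorem noisyOracle_mark {r : ℝ} (hr0 : 0 ≤ r) (hr1 : r ≤ 1) (j : Fin (m + 1))
    (x : Fin (2 ^ m)) (ρ : Op m W) :
    noisyOracle (mark x) j r ρ =
      ∑ k, pairKraus W j r (fun k => reflSign j (x, true) k.1) k * ρ *
        (pairKraus W j r (fun k => reflSign j (x, true) k.1) k)ᴴ := by
  simp only [pairKraus_conj hr0 hr1]
  rw [noisyOracle, noise_eq j r (oracleCall _ _), oracleCall, noise_eq, Fintype.sum_prod_type,
    Finset.sum_comm]
  refine Finset.sum_congr rfl fun Q _ => ?_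
  simp only [Finset.mul_sum, Finset.sum_mul, Finset.smul_sum]
  refine Finset.sum_congr rfl fun P _ => ?_
  simp only [Matrix.mul_smul, Matrix.smul_mul, smul_smul]
  rw [mul_comm, ← Complex.ofReal_mul]
  congr 1
  have h := onQuery_phaseOracle_mark (W := W) x j P
  calc _ = onQuery W (onQubit j (pauli Q)) *
        ((onQuery W (phaseOracle (mark x)) * onQuery W (onQubit j (pauli P))) * ρ *
          (onQuery W (phaseOracle (mark x)) * onQuery W (onQubit j (pauli P)))ᴴ) *
        (onQuery W (onQubit j (pauli Q)))ᴴ := by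
          simp only [Matrix.conjTranspose_mul, Matrix.mul_assoc]
    _ = _ := by
      rw [h]
      simp only [Matrix.conjTranspose_mul, Matrix.mul_assoc, pauliPair, onQuery_mul,
        diagOp_conjTranspose]

/-- The part of the reflection that is not revealed to the environment: when exactly one of the two
Pauli operators is a bit flip `X` and the other is trivial, the environment decoheres the two
possible reflections. -/
noncomputable def blurSign (j : Fin (m + 1)) (v : Query m) (k : Fin 4 × Fin 4) (q : Query m) : ℝ :=
  if k = (0, 1) ∨ k = (1, 0) then (reflSign j v 0 q + reflSign j v 1 q) / 2
  else reflSign j v k.1 q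

/-- With `E` and `D` the half sum and half difference of the two reflections, `(E + D)ρ(E + D) + (E
- D)ρ(E - D) = 2EρE + 2DρD`. Blurring drops exactly the positive term in `D`, which is supported on
the two reflected basis states. -/
theorem noisyOracle_sub_blur_posSemidef {r : ℝ} (hr0 : 0 ≤ r) (hr1 : r ≤ 1) (j : Fin (m + 1))
    (v : Query m) {ρ : Op m W} (hρ : ρ.PosSemidef) :
    (∑ k, pairKraus W j r (fun k => reflSign j v k.1) k * ρ *
        (pairKraus W j r (fun k => reflSign j v k.1) k)ᴴ -
      ∑ k, pairKraus W j r (blurSign j v) k * ρ *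
        (pairKraus W j r (blurSign j v) k)ᴴ).PosSemidef := by
  have hw := mul_nonneg (weight_nonneg hr0 hr1 0) (weight_nonneg hr0 hr1 1)
  obtain ⟨D, hD⟩ : ∃ D, D = diagOp W fun q => (reflSign j v 0 q - reflSign j v 1 q) / 2 := ⟨_, rfl⟩
  obtain ⟨E, hE⟩ : ∃ E, E = diagOp W fun q => (reflSign j v 0 q + reflSign j v 1 q) / 2 := ⟨_, rfl⟩
  have h0 : diagOp W (reflSign j v 0) = E + D := by
    rw [hE, hD, ← diagOp_add]
    congr 1; ext q; ring
  have h1 : diagOp W (reflSign j v 1) = E - D := by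
    rw [hE, hD, ← diagOp_sub]
    congr 1; ext q; ring
  have hb0 : diagOp W (blurSign j v (0, 1)) = E := by
    rw [hE]; congr 1
  have hb1 : diagOp W (blurSign j v (1, 0)) = E := by
    rw [hE]; congr 1
  have hDD : Dᴴ = D := by rw [hD, diagOp_conjTranspose]
  -- The crux: both error histories yield the same operator `X`, so their cross terms can cancel.
  have hpair : pauliPair W j (1, 0) = pauliPair W j (0, 1) := by
    simp only [pauliPair, onQubit_pauli_zero, Matrix.one_mul, Matrix.mul_one]
  have hsum : ∑ k, pairKraus W j r (fun k => reflSign j v k.1) k * ρ *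
        (pairKraus W j r (fun k => reflSign j v k.1) k)ᴴ -
      ∑ k, pairKraus W j r (blurSign j v) k * ρ * (pairKraus W j r (blurSign j v) k)ᴴ =
      ((weight r 0 * weight r 1 : ℝ) : ℂ) •
        (pauliPair W j (0, 1) * ((2 : ℂ) • (D * ρ * Dᴴ)) * (pauliPair W j (0, 1))ᴴ) := by
    simp only [pairKraus_conj hr0 hr1]
    rw [← Finset.sum_sub_distrib, ← Finset.sum_subset (Finset.subset_univ {(0, 1), (1, 0)})]
    · rw [Finset.sum_pair (by decide), hpair, h0, h1, hb0, hb1, hDD]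
      have hx : (2 : ℂ) • (D * ρ * D) = ((E + D) * ρ * (E + D) - E * ρ * E) +
          ((E - D) * ρ * (E - D) - E * ρ * E) := by
        simp only [Matrix.add_mul, Matrix.mul_add, Matrix.sub_mul, Matrix.mul_sub, two_smul]
        abel
      rw [hx]
      generalize (E + D) * ρ * (E + D) = S, (E - D) * ρ * (E - D) = T, E * ρ * E = R
      simp only [mul_comm (weight r 1), Matrix.mul_add, Matrix.add_mul, Matrix.mul_sub,
        Matrix.sub_mul, smul_add, smul_sub]
    · intro k _ hk
      simp only [Finset.mem_insert, Finset.mem_singleton] at hk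
      have : blurSign j v k = reflSign j v k.1 := by
        ext q
        simp [blurSign, hk]
      rw [this, sub_self]
  rw [hsum]
  refine Matrix.PosSemidef.smul ?_ (by exact_mod_cast hw)
  exact ((hρ.mul_mul_conjTranspose_same D).smul (by norm_num)).mul_mul_conjTranspose_same _

end NoisyOracle

/-! ### Growth of the potential in one query -/

section Potential

variable {m : ℕ} {W : Type} [Fintype W] [DecidableEq W]

/-- Number of the two possible reflections that act on the basis state `q`. -/
noncomputable def charge (j : Fin (m + 1)) (v q : Query m) : ℝ :=
  (if q = v then 1 else 0) + (if toggle j true q = v then 1 else 0)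

theorem reflSign_eq (j : Fin (m + 1)) (v : Query m) (P : Fin 4) (q : Query m) :
    reflSign j v P q =
      if flips P then (if toggle j true q = v then -1 else 1) else (if q = v then -1 else 1) := by
  unfold reflSign
  cases flips P <;> simp

/-- Completing the square in `b`: the damping `r / 8 * b ^ 2` pays for the cross term, at the price
of a multiple of `a ^ 2` alone. -/
theorem damped_cross_term_le {r a b c : ℝ} (hr0 : 0 < r) (hc : c ^ 2 ≤ 1) :
    8 * c * (a * b) - r / 8 * b ^ 2 ≤ 128 / r * a ^ 2 := by
  have h : 0 ≤ (r / 8) * (b - 32 * c * a / r) ^ 2 := by positivity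
  have h2 : (r / 8) * (b - 32 * c * a / r) ^ 2 =
      r / 8 * b ^ 2 - 8 * c * (a * b) + 128 / r * a ^ 2 * c ^ 2 := by
    field_simp
    ring
  have h3 : 128 / r * a ^ 2 * c ^ 2 ≤ 128 / r * a ^ 2 * 1 := by gcongr
  linarith

/-- Here `a` and `b` stand for real or imaginary parts of amplitudes of `Ψ` and `Φ`. Off the two
reflected states all signs are `1` and nothing changes. On them the average sign shifts the cross
term, while the two blurred branches remove part of `b ^ 2`. -/
theorem sum_blurSign_le {r : ℝ} (hr0 : 0 < r) (hr1 : r ≤ 1) (j : Fin (m + 1)) (v q : Query m)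
    (a b : ℝ) :
    ∑ k : Fin 4 × Fin 4, weight r k.1 * weight r k.2 *
        (2 * (a - blurSign j v k q * b) ^ 2 - (blurSign j v k q * b) ^ 2) ≤
      2 * (a - b) ^ 2 - b ^ 2 + 128 / r * charge j v q * a ^ 2 := by
  have hne := toggle_true_ne j q
  have hb2 := sq_nonneg b
  -- The right side is the joint probability `2 * weight r 0 * weight r 1` of the blurred branches.
  have hg : r / 8 ≤ r / 2 * (1 - 3 * r / 4) := by nlinarith
  have hgb := mul_le_mul_of_nonneg_right hg hb2
  simp only [Fintype.sum_prod_type, Fin.sum_univ_four, blurSign, reflSign_eq, charge]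
  simp only [flips, weight, Matrix.cons_val]
  by_cases h1 : q = v
  · have h2 : toggle j true q ≠ v := h1 ▸ hne
    -- The mean sign is `r - 1` at `v` and `1 - r` at its toggle; `c` is half of one minus that
    -- mean.
    have h := damped_cross_term_le (a := a) (b := b)
      (c := 1 - r / 2) hr0 (by nlinarith)
    simp [h1, h1 ▸ h2]
    nlinarith
  · by_cases h2 : toggle j true q = v
    · have h := damped_cross_term_le (a := a) (b := b) (c := r / 2) hr0 (by nlinarith)
      simp [h1, h2]
      nlinarith
    · simp [h1, h2]
      nlinarith

/-- Each of `q` and its toggle equals `(x, true)` for at most one `x`. -/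
theorem sum_charge_le (j : Fin (m + 1)) (q : Query m) :
    ∑ x : Fin (2 ^ m), charge j (x, true) q ≤ 2 := by
  have key : ∀ p : Query m, ∑ x : Fin (2 ^ m), (if p = (x, true) then (1 : ℝ) else 0) ≤ 1 := by
    intro p
    calc _ ≤ ∑ x : Fin (2 ^ m), (if p.1 = x then (1 : ℝ) else 0) := by
          refine Finset.sum_le_sum fun x _ => ?_
          by_cases h : p = (x, true)
          · simp [h]
          · rw [if_neg h]
            split_ifs <;> norm_num
      _ = 1 := by simp
  simp only [charge, Finset.sum_add_distrib]
  linarith [key q, key (toggle j true q)]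

theorem blur_potential_le {r : ℝ} (hr0 : 0 < r) (hr1 : r ≤ 1) (j : Fin (m + 1)) (v : Query m)
    {I : Type} [Fintype I] (Ψ Φ : Matrix (Query m × W) I ℂ) :
    ∑ k : Fin 4 × Fin 4, weight r k.1 * weight r k.2 *
        (2 * normSq (Ψ - diagOp W (blurSign j v k) * Φ) -
          normSq (diagOp W (blurSign j v k) * Φ)) ≤
      2 * normSq (Ψ - Φ) - normSq Φ +
        128 / r * ∑ z, ∑ i, charge j v z.1 * Complex.normSq (Ψ z i) := by
  simp only [normSq, Finset.mul_sum, ← Finset.sum_sub_distrib, ← Finset.sum_add_distrib]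
  rw [Finset.sum_comm]
  refine Finset.sum_le_sum fun z _ => ?_
  rw [Finset.sum_comm]
  refine Finset.sum_le_sum fun i _ => ?_
  simp only [Matrix.sub_apply, diagOp_mul_apply, Complex.normSq_apply, Complex.sub_re,
    Complex.sub_im, Complex.re_ofReal_mul, Complex.im_ofReal_mul]
  have h1 := sum_blurSign_le hr0 hr1 j v z.1 (Ψ z i).re (Φ z i).re
  have h2 := sum_blurSign_le hr0 hr1 j v z.1 (Ψ z i).im (Φ z i).im
  refine le_trans (le_of_eq ?_) ((add_le_add h1 h2).trans (le_of_eq (by ring)))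
  rw [← Finset.sum_add_distrib]
  exact Finset.sum_congr rfl fun k _ => by ring

end Potential

/-! ### Tracked families of states, and what a measurement learns from them -/

section Tracking

variable {X N : Type} [Fintype X] [DecidableEq X] [Fintype N]

/-- The states `ρ x` contain subnormalized states `Φ x (Φ x)ᴴ` that are close to a common reference
state `Ψ Ψᴴ`, where `b` bounds the total distance plus the total missing weight. -/
def Tracked (ρ : N → Matrix X X ℂ) (b : ℝ) : Prop :=
  ∃ (I : Type) (_ : Fintype I) (Ψ : Matrix X I ℂ) (Φ : N → Matrix X I ℂ), normSq Ψ = 1 ∧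
    (∀ x, (ρ x - Φ x * (Φ x)ᴴ).PosSemidef) ∧
    ∑ x, (2 * normSq (Ψ - Φ x) + (1 - normSq (Φ x))) ≤ b

theorem tracked_const {ρ : Matrix X X ℂ} (hρ : ρ.PosSemidef) (htr : ρ.trace = 1) :
    Tracked (fun _ : N => ρ) 0 := by
  obtain ⟨B, rfl⟩ := exists_eq_mul_conjTranspose hρ
  have hB : normSq B = 1 := by rw [normSq_eq_trace, htr, Complex.one_re]
  refine ⟨X, inferInstance, B, fun _ => B, hB, fun _ => ?_, ?_⟩
  · simpa using Matrix.PosSemidef.zero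
  · have h0 : normSq (0 : Matrix X X ℂ) = 0 := by simp [normSq]
    simp [h0, hB]

/-- Stacking the Kraus branches is an isometry on purifications, so distances and norms are
unchanged. -/
theorem Tracked.channel {ρ : N → Matrix X X ℂ} {b : ℝ} (h : Tracked ρ b) (C : Channel X) :
    Tracked (fun x => C.apply (ρ x)) b := by
  obtain ⟨I, _, Ψ, Φ, hΨ, hpos, hb⟩ := h
  refine ⟨I × Fin C.num, inferInstance, stack fun k => C.kraus k * Ψ,
    fun x => stack fun k => C.kraus k * Φ x, ?_, fun x => ?_, ?_⟩
  · rw [normSq_stack, sum_normSq_mul _ C.complete, hΨ]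
  · have := kraus_posSemidef C.kraus (hpos x)
    rw [kraus_sub] at this
    rwa [kraus_gram]
  · simpa only [stack_sub, ← Matrix.mul_sub, normSq_stack, sum_normSq_mul _ C.complete] using hb

theorem Tracked.sum_success_le {ρ : N → Matrix X X ℂ} {b : ℝ} (h : Tracked ρ b)
    (hρ : ∀ x, (ρ x).trace = 1) (M : N → Matrix X X ℂ) (hM : ∀ x, (M x).PosSemidef)
    (hsum : ∑ x, M x = 1) : ∑ x, ((M x * ρ x).trace).re ≤ 2 + b := by
  classical
  obtain ⟨I, _, Ψ, Φ, hΨ, hpos, hb⟩ := h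
  have hcompl : ∀ x, (1 - M x).PosSemidef := by
    intro x
    rw [← hsum, ← Finset.add_sum_erase _ _ (Finset.mem_univ x), add_sub_cancel_left]
    exact Matrix.posSemidef_sum _ fun y _ => hM y
  choose B hB using fun x => exists_eq_mul_conjTranspose (hM x)
  have htr : ∀ (x : N) (R : Matrix X I ℂ), ((M x * (R * Rᴴ)).trace).re = normSq ((B x)ᴴ * R) := by
    intro x R
    rw [normSq_eq_trace, hB x]
    congr 1
    rw [Matrix.mul_assoc, Matrix.trace_mul_comm]
    simp only [Matrix.conjTranspose_mul, Matrix.conjTranspose_conjTranspose, Matrix.mul_assoc]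
  have hle : ∀ (x : N) (R : Matrix X X ℂ), R.PosSemidef → ((M x * R).trace).re ≤ R.trace.re := by
    intro x R hR
    have := trace_mul_nonneg_of_posSemidef (hcompl x) hR
    rw [Matrix.sub_mul, Matrix.one_mul, Matrix.trace_sub, Complex.sub_re] at this
    linarith
  -- The untracked part contributes at most its trace `1 - ‖Φ x‖²`; the tracked part is compared
  -- with `Ψ`, whose outcome probabilities sum to 1 over `x`.
  have hone : ∀ x, ((M x * ρ x).trace).re ≤ 2 * ((M x * (Ψ * Ψᴴ)).trace).re +
      (2 * normSq (Ψ - Φ x) + (1 - normSq (Φ x))) := by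
    intro x
    have h1 := hle x _ (hpos x)
    rw [Matrix.mul_sub, Matrix.trace_sub, Matrix.trace_sub, Complex.sub_re, Complex.sub_re, hρ,
      ← normSq_eq_trace, Complex.one_re, htr] at h1
    have h2 := normSq_sub_le ((B x)ᴴ * Φ x) ((B x)ᴴ * Ψ)
    have h3 : normSq ((B x)ᴴ * (Ψ - Φ x)) ≤ normSq (Ψ - Φ x) := by
      rw [← htr, normSq_eq_trace]
      exact hle x _ (Matrix.posSemidef_self_mul_conjTranspose _)
    rw [← Matrix.mul_sub] at h2
    rw [htr]
    linarith
  have htot : ∑ x, ((M x * (Ψ * Ψᴴ)).trace).re = 1 := by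
    rw [← Complex.re_sum, ← Matrix.trace_sum, ← Finset.sum_mul, hsum, Matrix.one_mul,
      ← normSq_eq_trace, hΨ]
  refine (Finset.sum_le_sum fun x _ => hone x).trans ?_
  rw [Finset.sum_add_distrib, ← Finset.mul_sum, htot]
  linarith

end Tracking

/-! ### Accumulating the potential over all queries -/

section LowerBound

variable {m : ℕ} {W : Type} [Fintype W] [DecidableEq W]

theorem Tracked.noisyOracle {ρ : Fin (2 ^ m) → Op m W} {b r : ℝ} (h : Tracked ρ b) (hr0 : 0 < r)
    (hr1 : r ≤ 1) (j : Fin (m + 1)) :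
    Tracked (fun x => noisyOracle (mark x) j r (ρ x)) (b + 256 / r) := by
  obtain ⟨I, _, Ψ, Φ, hΨ, hpos, hb⟩ := h
  have hone : ∀ M : Matrix (Query m × W) I ℂ, diagOp W (fun _ : Query m => 1) * M = M := fun M => by
    rw [diagOp_one, Matrix.one_mul]
  -- The reference undergoes the same Pauli errors with a trivial oracle, so its new purification
  -- does not depend on `x`.
  refine ⟨I × (Fin 4 × Fin 4), inferInstance, stack fun k => pairKraus W j r (fun _ _ => 1) k * Ψ,
    fun x => stack fun k => pairKraus W j r (blurSign j (x, true)) k * Φ x, ?_, fun x => ?_, ?_⟩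
  · rw [normSq_stack, sum_normSq_mul _ (pairKraus_complete hr0.le hr1 j _ fun _ _ => by simp), hΨ]
  · have h1 := noisyOracle_sub_blur_posSemidef (W := W) hr0.le hr1 j (x, true)
      (Matrix.posSemidef_self_mul_conjTranspose (Φ x))
    have h2 := kraus_posSemidef (pairKraus W j r fun k => reflSign j (x, true) k.1) (hpos x)
    rw [kraus_sub, ← noisyOracle_mark hr0.le hr1] at h2
    rw [kraus_gram]
    simpa using h2.add h1
  · have hstep : ∀ x, 2 * normSq ((stack fun k => pairKraus W j r (fun _ _ => 1) k * Ψ) -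
          stack fun k => pairKraus W j r (blurSign j (x, true)) k * Φ x) +
        (1 - normSq (stack fun k => pairKraus W j r (blurSign j (x, true)) k * Φ x)) ≤
        (2 * normSq (Ψ - Φ x) + (1 - normSq (Φ x))) +
          128 / r * ∑ z, ∑ i, charge j (x, true) z.1 * Complex.normSq (Ψ z i) := by
      intro x
      have hd : ∀ k, pairKraus W j r (fun _ _ => 1) k * Ψ -
          pairKraus W j r (blurSign j (x, true)) k * Φ x =
          pairKraus W j r (fun _ _ => 1) k * (Ψ - diagOp W (blurSign j (x, true) k) * Φ x) := by
        intro k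
        rw [Matrix.mul_sub, ← Matrix.mul_assoc (pairKraus W j r _ k)]
        congr 2
        simp only [pairKraus, diagOp_one, Matrix.mul_one, Matrix.smul_mul]
      have hp := blur_potential_le hr0 hr1 j (x, true) Ψ (Φ x)
      rw [stack_sub, normSq_stack, normSq_stack]
      simp only [hd, normSq_pairKraus_mul hr0.le hr1, hone]
      have he : ∑ k : Fin 4 × Fin 4, weight r k.1 * weight r k.2 *
          (2 * normSq (Ψ - diagOp W (blurSign j (x, true) k) * Φ x) -
            normSq (diagOp W (blurSign j (x, true) k) * Φ x)) =
          2 * ∑ k : Fin 4 × Fin 4, weight r k.1 * weight r k.2 *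
            normSq (Ψ - diagOp W (blurSign j (x, true) k) * Φ x) -
          ∑ k : Fin 4 × Fin 4, weight r k.1 * weight r k.2 *
            normSq (diagOp W (blurSign j (x, true) k) * Φ x) := by
        rw [Finset.mul_sum, ← Finset.sum_sub_distrib]
        exact Finset.sum_congr rfl fun k _ => by ring
      rw [he] at hp
      linarith
    have hcharge : ∑ x : Fin (2 ^ m), ∑ z : Query m × W, ∑ i,
        charge j (x, true) z.1 * Complex.normSq (Ψ z i) ≤ 2 := by
      have h2 : (2 : ℝ) = 2 * ∑ z, ∑ i, Complex.normSq (Ψ z i) := by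
        rw [← normSq, hΨ, mul_one]
      rw [Finset.sum_comm, h2, Finset.mul_sum]
      refine Finset.sum_le_sum fun z _ => ?_
      rw [Finset.sum_comm, Finset.mul_sum]
      refine Finset.sum_le_sum fun i _ => ?_
      rw [← Finset.sum_mul]
      exact mul_le_mul_of_nonneg_right (sum_charge_le j z.1) (Complex.normSq_nonneg _)
    refine (Finset.sum_le_sum fun x _ => hstep x).trans ?_
    rw [Finset.sum_add_distrib, ← Finset.mul_sum]
    have := mul_le_mul_of_nonneg_left hcharge (by positivity : (0 : ℝ) ≤ 128 / r)
    have h256 : 128 / r * 2 = 256 / r := by ring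
    linarith

theorem tracked_state (A : Algorithm m) {r : ℝ} (hr0 : 0 < r) (hr1 : r ≤ 1) (j : Fin (m + 1))
    (t : ℕ) : Tracked (fun x => A.state j r (mark x) t) (t * (256 / r)) := by
  induction t with
  | zero => simpa [Algorithm.state] using tracked_const A.init_posSemidef A.init_trace
  | succ t ih =>
    have := (ih.noisyOracle hr0 hr1 j).channel (A.step t)
    rw [Nat.cast_succ, add_one_mul]
    exact this

theorem trace_state (A : Algorithm m) {r : ℝ} (hr0 : 0 ≤ r) (hr1 : r ≤ 1) (j : Fin (m + 1))
    (x : Fin (2 ^ m)) (t : ℕ) : (A.state j r (mark x) t).trace = 1 := by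
  induction t with
  | zero => exact A.init_trace
  | succ t ih =>
    rw [Algorithm.state, Channel.apply, kraus_trace _ (A.step t).complete,
      noisyOracle_mark hr0 hr1, kraus_trace _ (pairKraus_complete hr0 hr1 j _ fun k q => ?_), ih]
    exact reflSign_sq j _ _ q

theorem successProb_mark (A : Algorithm m) (j : Fin (m + 1)) (r : ℝ) (x : Fin (2 ^ m)) :
    A.successProb j r (mark x) = ((A.povm x * A.state j r (mark x) A.queries).trace).re := by
  rw [Algorithm.successProb, Finset.sum_eq_single x]
  · intro y hy hyx
    simp [mark, hyx] at hy
  · simp [mark]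

theorem sum_successProb_le (A : Algorithm m) {r : ℝ} (hr0 : 0 < r) (hr1 : r ≤ 1)
    (j : Fin (m + 1)) :
    ∑ x, A.successProb j r (mark x) ≤ 2 + A.queries * (256 / r) := by
  simp only [successProb_mark]
  exact (tracked_state A hr0 hr1 j A.queries).sum_success_le
    (fun x => trace_state A hr0.le hr1 j x _) A.povm A.povm_posSemidef A.povm_sum

end LowerBound

end NoisySearch

theorem theorem1 (m : ℕ) (j : Fin (m + 1)) (r ε : ℝ) (hr0 : 0 ≤ r) (hr1 : r ≤ 1)
    (A : NoisySearch.Algorithm m) (hA : A.SolvesSearch j r (1 - ε)) :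
    (2 : ℝ) ^ m * r * (1 - ε) / 2000 - 1 ≤ (A.queries : ℝ) := by
  have hq : (0 : ℝ) ≤ A.queries := Nat.cast_nonneg _
  -- The potential bound needs `r > 0`; at `r = 0` the claimed bound is `-1`.
  rcases hr0.eq_or_lt with rfl | hr
  · simp only [mul_zero, zero_mul, zero_div]
    linarith
  have hle := NoisySearch.sum_successProb_le A hr hr1 j
  have hge : (2 : ℝ) ^ m * (1 - ε) ≤ ∑ x, A.successProb j r (NoisySearch.mark x) := by
    calc (2 : ℝ) ^ m * (1 - ε) = ∑ _x : Fin (2 ^ m), (1 - ε) := by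
          rw [Finset.sum_const, Finset.card_univ, Fintype.card_fin, nsmul_eq_mul]
          push_cast
          rfl
      _ ≤ _ := Finset.sum_le_sum fun x _ =>
        hA _ ⟨x, by simp [NoisySearch.mark], fun y hy => by simpa [NoisySearch.mark] using hy⟩
  have h := mul_le_mul_of_nonneg_right (hge.trans hle) hr0
  have h2 : (2 + A.queries * (256 / r)) * r = 2 * r + 256 * A.queries := by
    field_simp
  -- From `2 ^ m * r * (1 - ε) ≤ 2 * r + 256 * A.queries`; the constant 2000 leaves ample slack.
  linarith
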